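/- Let $d\ge 1$ be an integer and let $\nu,\alpha,\beta,\sigma^2>0$. The Confluent Hypergeometric (CH) covariance function on $\mathbb{R}^d$ is $x\mapsto C(|x|)$, where $$C(h)=\frac{\sigma^2\beta^{2\alpha}\Gamma(\nu+\alpha)}{\Gamma(\nu)\Gamma(\alpha)}\int_0^\infty x^{\nu-1}(x+\beta^2)^{-(\nu+\alpha)}\exp(-\nu h^2/x)\,dx .$$ A spectral density of it is a continuous function $f:[0,\infty)\to[0,\infty]$ with $\int_{\mathbb{R}^d} f(|\omega|)\,d\omega<\infty$ and $C(|x|)=\int_{\mathbb{R}^d}e^{i x^\top\omega}f(|\omega|)\,d\omega$ for all $x\in\mathbb{R}^d$. Then $C$ has exactly one spectral density $f$, and $$f(\omega)\sim\frac{\sigma^2\,2^{2\nu}\nu^\nu\,\Gamma(\nu+\alpha)}{\pi^{d/2}\beta^{2\nu}\,\Gamma(\alpha)}\cdot\frac{\Gamma(\nu+d/2)}{\Gamma(\nu)}\;\omega^{-(2\nu+d)}L(\omega^2),\qquad \omega\to\infty,$$ where $L(x)=\{x/(x+\beta^2/(2\nu))\}^{\nu+d/2}$ is slowly varying at $\infty$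 (that is, $L(tx)/L(x)\to 1$ as $x\to\infty$ for every $t>0$), and $\sim$ means that the ratio tends to $1$. If moreover $\alpha>d/2$, then $f(\omega)<\infty$ for every $\omega\ge 0$, the function $x\mapsto C(|x|)$ is integrable on $\mathbb{R}^d$, and $f(|\omega|)=(2\pi)^{-d}\int_{\mathbb{R}^d}e^{-i\omega^\top x}C(|x|)\,dx$ for all $\omega\in\mathbb{R}^d$. -/

import Mathlib

open MeasureTheory Filter Topology Asymptotics
open scoped NNReal ENNReal

noncomputable section

/-- The confluent hypergeometric (CH) covariance function `C(h; ν, α, β, σ²)`. -/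
def chCov (ν α β σ h : ℝ) : ℝ :=
  σ ^ 2 * β ^ (2 * α) * Real.Gamma (ν + α) / (Real.Gamma ν * Real.Gamma α) *
    ∫ x in Set.Ioi (0 : ℝ),
      x ^ (ν - 1) * (x + β ^ 2) ^ (-(ν + α)) * Real.exp (-(ν * h ^ 2 / x))

/-- `f : [0, ∞) → [0, ∞]` is the (continuous) spectral density of the isotropic covariance function
`x ↦ C ‖x‖` on `ℝ^d`: the measure `f(‖ω‖) dω` is finite, and its Fourier transform is the covariance,
`C(‖x‖) = ∫ exp(i ⟨x, ω⟩) f(‖ω‖) dω` for every `x`. Continuity fixes the version of the density;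
the value `∞` is allowed because the density may have a pole at frequency zero. -/
def IsSpectralDensity (d : ℕ) (C : ℝ → ℝ) (f : ℝ≥0 → ℝ≥0∞) : Prop :=
  Continuous f ∧
  (∫⁻ ω : EuclideanSpace ℝ (Fin d), f ‖ω‖₊) < ∞ ∧
  ∀ x : EuclideanSpace ℝ (Fin d),
    (C ‖x‖ : ℂ) = ∫ ω : EuclideanSpace ℝ (Fin d),
      Complex.exp (Complex.I * (inner ℝ x ω : ℝ)) * ((f ‖ω‖₊).toReal : ℂ)

/-- Slow variation at infinity. -/
def SlowlyVarying (L : ℝ → ℝ) : Prop :=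
  ∀ t : ℝ, 0 < t → Tendsto (fun x => L (t * x) / L x) atTop (𝓝 1)

/-- The function `L(x) = {x / (x + β²/(2ν))}^{ν + d/2}`. -/
def tailL (d : ℕ) (ν β x : ℝ) : ℝ :=
  (x / (x + β ^ 2 / (2 * ν))) ^ (ν + (d : ℝ) / 2)

end

/-!
Both the covariance and its spectral density are scale mixtures of Gaussians. The Fourier transform
of `exp (-b ‖x‖²)` is `(π / b) ^ (n / 2) * exp (-‖y‖² / (4 b))`, so by Fubini the Fourier transform
of a mixture with weight `w` and rate `b` is the mixture with weight `w (π / b) ^ (n / 2)` and rate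
`1 / (4 b)`; this duality is an involution up to the factor `(2 π) ^ n`. The CH covariance is the
dual of the mixture with rate `u / (4 ν)` and a weight proportional to
`u ^ (ν + d / 2 - 1) * (u + β²) ^ (-(ν + α))`, and as a function of `l = ω² / (4 ν)` the latter
mixture is a Laplace transform. Its behaviour for large `l` is governed by the weight near `u = 0`
(Watson's lemma), which gives the tail. The condition `d / 2 < α` makes the weight itself
integrable, so that the duality can be applied a second time. Uniqueness holds because a finite
measure is determined by its characteristic function.
-/

noncomputable section GaussianMixture

open Real Module

variable {Ω : Type*} {mΩ : MeasurableSpace Ω} {μ : Measure Ω} {n : ℕ} {w b : Ω → ℝ}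

/-- The scale mixture of Gaussians with weight `w` and rate `b` over the parameter space `(Ω, μ)`,
as a function of the radius `r`. -/
def gaussianMixture (μ : Measure Ω) (w b : Ω → ℝ) (r : ℝ) : ℝ :=
  ∫ u, w u * exp (-(b u * r ^ 2)) ∂μ

/-- The scale mixture of Gaussians with nonnegative weight `w`, as an extended nonnegative number:
unlike `gaussianMixture`, it is `∞` rather than `0` where the integral diverges, which may happen
at `r = 0`. Negative values of `w` are truncated to `0`. -/
def egaussianMixture (μ : Measure Ω) (w b : Ω → ℝ) (r : ℝ≥0) : ℝ≥0∞ :=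
  ∫⁻ u, ENNReal.ofReal (w u * exp (-(b u * (r : ℝ) ^ 2))) ∂μ

/-- The weight of the Fourier transform, over an `n`-dimensional space, of the mixture of Gaussians
with weight `w` and rate `b`. -/
def dualWeight (n : ℕ) (w b : Ω → ℝ) (u : Ω) : ℝ :=
  w u * (π / b u) ^ ((n : ℝ) / 2)

/-- The rate of the Fourier transform of a mixture of Gaussians with rate `b`. -/
def dualRate (b : Ω → ℝ) (u : Ω) : ℝ :=
  1 / (4 * b u)

/-- The weight `w` and the rate `b` define a mixture of Gaussians that is integrable over an
`n`-dimensional space: `dualWeight n w b u` is the integral of the Gaussian with parameter `u`. -/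
structure IsGaussianMixing (n : ℕ) (μ : Measure Ω) (w b : Ω → ℝ) : Prop where
  aemeasurable_weight : AEMeasurable w μ
  aemeasurable_rate : AEMeasurable b μ
  rate_pos : ∀ᵐ u ∂μ, 0 < b u
  integrable_dualWeight : Integrable (dualWeight n w b) μ

theorem dualRate_dualRate : dualRate (dualRate b) = b := by
  ext u
  simp only [dualRate]
  field_simp

theorem dualWeight_dualWeight {u : Ω} (hb : 0 < b u) :
    dualWeight n (dualWeight n w b) (dualRate b) u = (2 * π) ^ n * w u := by
  have hpow : ((2 * π) ^ 2) ^ ((n : ℝ) / 2) = (2 * π) ^ n := by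
    rw [← rpow_natCast_mul (by positivity), Nat.cast_ofNat, mul_div_cancel₀ _ two_ne_zero,
      rpow_natCast]
  have hbase : π / b u * (π / (1 / (4 * b u))) = (2 * π) ^ 2 := by
    field_simp
    norm_num
  rw [dualWeight, dualWeight, dualRate, mul_assoc, ← mul_rpow (by positivity) (by positivity),
    hbase, hpow, mul_comm]

theorem gaussianMixture_const_mul (c r : ℝ) :
    gaussianMixture μ (fun u => c * w u) b r = c * gaussianMixture μ w b r := by
  simp only [gaussianMixture, mul_assoc, integral_const_mul]

theorem gaussianMixture_congr {w' : Ω → ℝ} (hw : w =ᵐ[μ] w') (r : ℝ) :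
    gaussianMixture μ w b r = gaussianMixture μ w' b r :=
  integral_congr_ae (hw.mono fun u hu => by simp only [hu])

theorem toReal_egaussianMixture (hw : AEMeasurable w μ) (hb : AEMeasurable b μ) (hw0 : 0 ≤ᵐ[μ] w)
    (r : ℝ≥0) : (egaussianMixture μ w b r).toReal = gaussianMixture μ w b r := by
  rw [gaussianMixture, integral_eq_lintegral_of_nonneg_ae, egaussianMixture]
  · filter_upwards [hw0] with u hu using mul_nonneg hu (exp_nonneg _)
  · exact AEMeasurable.aestronglyMeasurable (by fun_prop)

theorem ae_ofReal_mul_exp_le (hb : ∀ᵐ u ∂μ, 0 ≤ b u) {r s : ℝ≥0} (hrs : r ≤ s) :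
    ∀ᵐ u ∂μ, ENNReal.ofReal (w u * exp (-(b u * (s : ℝ) ^ 2))) ≤
      ENNReal.ofReal (w u * exp (-(b u * (r : ℝ) ^ 2))) := by
  filter_upwards [hb] with u hu
  rw [ENNReal.ofReal_mul' (exp_nonneg _), ENNReal.ofReal_mul' (exp_nonneg _)]
  gcongr

theorem egaussianMixture_antitone (hb : ∀ᵐ u ∂μ, 0 ≤ b u) : Antitone (egaussianMixture μ w b) :=
  fun _ _ hrs => lintegral_mono_ae (ae_ofReal_mul_exp_le hb hrs)

theorem egaussianMixture_lt_top (hb : ∀ᵐ u ∂μ, 0 ≤ b u) (hw : Integrable w μ) (r : ℝ≥0) :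
    egaussianMixture μ w b r < ∞ :=
  calc egaussianMixture μ w b r ≤ egaussianMixture μ w b 0 := egaussianMixture_antitone hb zero_le
    _ < ∞ := by simpa [egaussianMixture] using hw.lintegral_lt_top

theorem continuous_egaussianMixture (hw : AEMeasurable w μ) (hb : AEMeasurable b μ)
    (hb0 : ∀ᵐ u ∂μ, 0 ≤ b u) (hfin : ∀ r, 0 < r → egaussianMixture μ w b r ≠ ∞) :
    Continuous (egaussianMixture μ w b) := by
  have hmeas (r : ℝ≥0) :
      AEMeasurable (fun u => ENNReal.ofReal (w u * exp (-(b u * (r : ℝ) ^ 2)))) μ := by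
    fun_prop
  have hlim (r : ℝ≥0) (u : Ω) :
      Tendsto (fun s : ℝ≥0 => ENNReal.ofReal (w u * exp (-(b u * (s : ℝ) ^ 2)))) (𝓝 r)
        (𝓝 (ENNReal.ofReal (w u * exp (-(b u * (r : ℝ) ^ 2))))) :=
    (ENNReal.continuous_ofReal.comp (by fun_prop)).tendsto r
  refine continuous_iff_continuousAt.2 fun r => ?_
  rcases eq_zero_or_pos r with rfl | hr
  -- No integrable majorant is available at `0`: use Fatou's lemma and monotonicity instead.
  · refine tendsto_of_le_liminf_of_limsup_le ?_ ?_
    · calc egaussianMixture μ w b 0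
          = ∫⁻ u, liminf (fun s : ℝ≥0 =>
              ENNReal.ofReal (w u * exp (-(b u * (s : ℝ) ^ 2)))) (𝓝 0) ∂μ :=
            lintegral_congr fun u => (hlim 0 u).liminf_eq.symm
        _ ≤ liminf (egaussianMixture μ w b) (𝓝 0) := lintegral_liminf_le' hmeas
    · exact limsup_le_of_le (by isBoundedDefault)
        (Eventually.of_forall fun s => egaussianMixture_antitone hb0 zero_le)
  · refine tendsto_lintegral_filter_of_dominated_convergence'
      (fun u => ENNReal.ofReal (w u * exp (-(b u * ((r / 2 : ℝ≥0) : ℝ) ^ 2))))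
      (Eventually.of_forall hmeas) ?_ (hfin _ (half_pos hr)) (ae_of_all _ (hlim r))
    filter_upwards [lt_mem_nhds (half_lt_self hr)] with s hs
    exact ae_ofReal_mul_exp_le hb0 hs.le

variable {V : Type*} [NormedAddCommGroup V] [InnerProductSpace ℝ V] [FiniteDimensional ℝ V]
  [MeasurableSpace V] [BorelSpace V]

theorem integrable_exp_neg_mul_sq_norm {c : ℝ} (hc : 0 < c) :
    Integrable fun x : V => exp (-(c * ‖x‖ ^ 2)) := by
  have h := GaussianFourier.integrable_cexp_neg_mul_sq_norm_add (V := V) (b := (c : ℂ))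
    (by simpa using hc) 0 0
  refine h.norm.congr (ae_of_all _ fun x => ?_)
  simp [Complex.norm_exp, ← Complex.ofReal_pow]

theorem integral_cexp_inner_mul_exp_neg_mul_sq_norm {c : ℝ} (hc : 0 < c) (y : V) :
    ∫ x : V, Complex.exp (Complex.I * (inner ℝ y x : ℝ)) * (exp (-(c * ‖x‖ ^ 2)) : ℝ) =
      ((π / c) ^ ((finrank ℝ V : ℝ) / 2) * exp (-(1 / (4 * c) * ‖y‖ ^ 2)) : ℝ) := by
  have h := GaussianFourier.integral_cexp_neg_mul_sq_norm_add (V := V) (b := (c : ℂ))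
    (by simpa using hc) Complex.I y
  have hpow : ((π / c : ℝ) : ℂ) ^ ((finrank ℝ V : ℂ) / 2) =
      ((π / c) ^ ((finrank ℝ V : ℝ) / 2) : ℝ) := by
    rw [Complex.ofReal_cpow (by positivity)]
    push_cast
    rfl
  rw [← Complex.ofReal_div, hpow, Complex.I_sq] at h
  push_cast at h ⊢
  convert h using 2
  · ext x
    rw [← Complex.exp_add]
    ring_nf
  · ring_nf

namespace IsGaussianMixing

theorem dual (h : IsGaussianMixing n μ w b) (hw : Integrable w μ) :
    IsGaussianMixing n μ (dualWeight n w b) (dualRate b) where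
  aemeasurable_weight := h.integrable_dualWeight.aemeasurable
  aemeasurable_rate := by
    have := h.aemeasurable_rate
    unfold dualRate
    fun_prop
  rate_pos := by
    filter_upwards [h.rate_pos] with u hu using one_div_pos.2 (mul_pos four_pos hu)
  integrable_dualWeight := by
    refine (hw.const_mul ((2 * π) ^ n)).congr ?_
    filter_upwards [h.rate_pos] with u hu using (dualWeight_dualWeight hu).symm

theorem integrable_prod (h : IsGaussianMixing n μ w b) (hV : finrank ℝ V = n) :
    Integrable (fun p : Ω × V => w p.1 * exp (-(b p.1 * ‖p.2‖ ^ 2))) (μ.prod volume) := by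
  subst hV
  have hw : AEMeasurable (fun p : Ω × V => w p.1) (μ.prod volume) := h.aemeasurable_weight.comp_fst
  have hb : AEMeasurable (fun p : Ω × V => b p.1) (μ.prod volume) := h.aemeasurable_rate.comp_fst
  have hmeas : AEStronglyMeasurable (fun p : Ω × V => w p.1 * exp (-(b p.1 * ‖p.2‖ ^ 2)))
      (μ.prod volume) :=
    (hw.mul (hb.mul (by fun_prop)).neg.exp).aestronglyMeasurable
  refine (integrable_prod_iff hmeas).2 ⟨?_, ?_⟩
  · filter_upwards [h.rate_pos] with u hu using (integrable_exp_neg_mul_sq_norm hu).const_mul (w u)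
  · refine h.integrable_dualWeight.norm.congr ?_
    filter_upwards [h.rate_pos] with u hu
    simp only [dualWeight, norm_mul, norm_of_nonneg (exp_nonneg _), integral_const_mul, ← neg_mul]
    rw [GaussianFourier.integral_rexp_neg_mul_sq_norm hu,
      norm_of_nonneg (rpow_nonneg (div_pos pi_pos hu).le _)]

variable [SFinite μ]

theorem integrable_norm (h : IsGaussianMixing n μ w b) (hV : finrank ℝ V = n) :
    Integrable fun x : V => gaussianMixture μ w b ‖x‖ :=
  (h.integrable_prod hV).integral_prod_right

theorem lintegral_nnnorm_lt_top (h : IsGaussianMixing n μ w b) (hV : finrank ℝ V = n) :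
    ∫⁻ x : V, egaussianMixture μ w b ‖x‖₊ < ∞ := by
  have hprod := h.integrable_prod hV
  have hlt := hprod.lintegral_lt_top
  rwa [lintegral_prod_symm _ hprod.aemeasurable.ennreal_ofReal] at hlt

theorem egaussianMixture_lt_top_of_pos (h : IsGaussianMixing n μ w b) {r : ℝ≥0} (hr : 0 < r) :
    egaussianMixture μ w b r < ∞ := by
  have hb : ∀ᵐ u ∂μ, 0 ≤ b u := h.rate_pos.mono fun _ => le_of_lt
  have hmeas : Measurable fun x : EuclideanSpace ℝ (Fin n) => egaussianMixture μ w b ‖x‖₊ :=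
    (egaussianMixture_antitone hb).measurable.comp measurable_nnnorm
  have hae := ae_lt_top hmeas (h.lintegral_nnnorm_lt_top finrank_euclideanSpace_fin).ne
  obtain ⟨x, hx, hxr⟩ := (Measure.dense_of_ae hae).exists_dist_lt 0 (NNReal.coe_pos.2 hr)
  rw [dist_zero_left] at hxr
  exact (egaussianMixture_antitone hb (show ‖x‖₊ ≤ r from hxr.le)).trans_lt hx

theorem integral_cexp_inner_mul (h : IsGaussianMixing n μ w b) (hV : finrank ℝ V = n) (y : V) :
    ∫ x : V, Complex.exp (Complex.I * (inner ℝ y x : ℝ)) * (gaussianMixture μ w b ‖x‖ : ℂ) =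
      gaussianMixture μ (dualWeight n w b) (dualRate b) ‖y‖ := by
  have hprod : Integrable (Function.uncurry fun (u : Ω) (x : V) =>
      Complex.exp (Complex.I * (inner ℝ y x : ℝ)) * ((w u * exp (-(b u * ‖x‖ ^ 2)) : ℝ) : ℂ))
      (μ.prod volume) := by
    refine (h.integrable_prod hV).ofReal.bdd_mul (c := 1)
      (f := fun p : Ω × V => Complex.exp (Complex.I * (inner ℝ y p.2 : ℝ)))
      (Measurable.aestronglyMeasurable (by fun_prop)) (ae_of_all _ fun p => ?_)
    rw [mul_comm, Complex.norm_exp_ofReal_mul_I]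
  have hgauss : ∀ᵐ u ∂μ, ∫ x : V, Complex.exp (Complex.I * (inner ℝ y x : ℝ)) *
      ((w u * exp (-(b u * ‖x‖ ^ 2)) : ℝ) : ℂ) =
      ((dualWeight n w b u * exp (-(dualRate b u * ‖y‖ ^ 2)) : ℝ) : ℂ) := by
    filter_upwards [h.rate_pos] with u hu
    simp only [Complex.ofReal_mul (w u), mul_left_comm _ (w u : ℂ), integral_const_mul]
    rw [integral_cexp_inner_mul_exp_neg_mul_sq_norm hu, hV, ← Complex.ofReal_mul, ← mul_assoc]
    rfl
  calc ∫ x : V, Complex.exp (Complex.I * (inner ℝ y x : ℝ)) * (gaussianMixture μ w b ‖x‖ : ℂ)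
      = ∫ x : V, ∫ u, Complex.exp (Complex.I * (inner ℝ y x : ℝ)) *
          ((w u * exp (-(b u * ‖x‖ ^ 2)) : ℝ) : ℂ) ∂μ := by
        simp only [gaussianMixture, integral_const_mul, integral_complex_ofReal]
    _ = ∫ u, (∫ x : V, Complex.exp (Complex.I * (inner ℝ y x : ℝ)) *
          ((w u * exp (-(b u * ‖x‖ ^ 2)) : ℝ) : ℂ)) ∂μ := (integral_integral_swap hprod).symm
    _ = gaussianMixture μ (dualWeight n w b) (dualRate b) ‖y‖ := by
        rw [integral_congr_ae hgauss, integral_complex_ofReal, gaussianMixture]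

theorem gaussianMixture_norm_eq_integral_cexp (h : IsGaussianMixing n μ w b) (hw : Integrable w μ)
    (hV : finrank ℝ V = n) (y : V) :
    (gaussianMixture μ w b ‖y‖ : ℂ) = 1 / (2 * (π : ℂ)) ^ n *
      ∫ x : V, Complex.exp (-(Complex.I * (inner ℝ y x : ℝ))) *
        (gaussianMixture μ (dualWeight n w b) (dualRate b) ‖x‖ : ℂ) := by
  have hdual : gaussianMixture μ (dualWeight n (dualWeight n w b) (dualRate b))
      (dualRate (dualRate b)) ‖-y‖ = (2 * π) ^ n * gaussianMixture μ w b ‖y‖ := by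
    rw [norm_neg, dualRate_dualRate, ← gaussianMixture_const_mul]
    exact gaussianMixture_congr (h.rate_pos.mono fun u hu => dualWeight_dualWeight hu) _
  have hfourier := (h.dual hw).integral_cexp_inner_mul hV (-y)
  simp only [hdual, inner_neg_left, Complex.ofReal_neg, mul_neg] at hfourier
  rw [hfourier]
  push_cast
  field_simp

theorem isSpectralDensity {d : ℕ} (h : IsGaussianMixing d μ w b) (hw : 0 ≤ᵐ[μ] w) :
    IsSpectralDensity d (gaussianMixture μ (dualWeight d w b) (dualRate b))
      (egaussianMixture μ w b) := by
  refine ⟨continuous_egaussianMixture h.aemeasurable_weight h.aemeasurable_rate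
    (h.rate_pos.mono fun _ => le_of_lt) fun r hr => (h.egaussianMixture_lt_top_of_pos hr).ne,
    h.lintegral_nnnorm_lt_top finrank_euclideanSpace_fin, fun x => ?_⟩
  simp only [toReal_egaussianMixture h.aemeasurable_weight h.aemeasurable_rate hw, coe_nnnorm]
  exact (h.integral_cexp_inner_mul finrank_euclideanSpace_fin x).symm

end IsGaussianMixing

end GaussianMixture

namespace IsSpectralDensity

variable {d : ℕ} {C : ℝ → ℝ} {f g : ℝ≥0 → ℝ≥0∞}

theorem charFun_withDensity (hf : IsSpectralDensity d C f) (x : EuclideanSpace ℝ (Fin d)) :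
    charFun ((volume : Measure (EuclideanSpace ℝ (Fin d))).withDensity fun ω => f ‖ω‖₊) x =
      C ‖x‖ := by
  obtain ⟨hcont, hfin, hC⟩ := hf
  have hmeas : Measurable fun ω : EuclideanSpace ℝ (Fin d) => f ‖ω‖₊ :=
    (hcont.comp continuous_nnnorm).measurable
  rw [charFun_apply, integral_withDensity_eq_integral_toReal_smul hmeas
    (ae_lt_top hmeas hfin.ne), hC x]
  congr with ω
  rw [Complex.real_smul, real_inner_comm, mul_comm, mul_comm Complex.I]

theorem unique (hd : 1 ≤ d) (hf : IsSpectralDensity d C f) (hg : IsSpectralDensity d C g) :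
    f = g := by
  have : Nonempty (Fin d) := Fin.pos_iff_nonempty.1 hd
  have hf_cont : Continuous fun ω : EuclideanSpace ℝ (Fin d) => f ‖ω‖₊ :=
    hf.1.comp continuous_nnnorm
  have hg_cont : Continuous fun ω : EuclideanSpace ℝ (Fin d) => g ‖ω‖₊ :=
    hg.1.comp continuous_nnnorm
  have := isFiniteMeasure_withDensity hf.2.1.ne
  have := isFiniteMeasure_withDensity hg.2.1.ne
  have hμ : (volume : Measure (EuclideanSpace ℝ (Fin d))).withDensity (fun ω => f ‖ω‖₊) =
      volume.withDensity (fun ω => g ‖ω‖₊) :=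
    Measure.ext_of_charFun <| funext fun x => by
      rw [hf.charFun_withDensity, hg.charFun_withDensity]
  rw [withDensity_eq_iff hf_cont.aemeasurable hg_cont.aemeasurable hf.2.1.ne,
    hf_cont.ae_eq_iff_eq volume hg_cont] at hμ
  funext r
  obtain ⟨x, hx⟩ := exists_norm_eq (EuclideanSpace ℝ (Fin d)) r.coe_nonneg
  obtain rfl : ‖x‖₊ = r := NNReal.eq hx
  exact congrFun hμ x

end IsSpectralDensity

section SlowVariation

open Real

theorem SlowlyVarying.of_tendsto {L : ℝ → ℝ} {c : ℝ} (hc : c ≠ 0) (hL : Tendsto L atTop (𝓝 c)) :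
    SlowlyVarying L := fun t ht => by
  simpa only [div_self hc] using! (hL.comp (tendsto_id.const_mul_atTop ht)).div hL hc

theorem tendsto_div_add_const_atTop (c : ℝ) :
    Tendsto (fun x : ℝ => x / (x + c)) atTop (𝓝 1) := by
  have h : (fun x : ℝ => x + c) ~[atTop] fun x => x :=
    IsEquivalent.refl.add_isLittleO (isLittleO_const_id_atTop c)
  refine (isEquivalent_iff_tendsto_one ?_).1 h.symm
  filter_upwards [eventually_gt_atTop (-c)] with x hx
  linarith

theorem tendsto_tailL (d : ℕ) (ν β : ℝ) : Tendsto (tailL d ν β) atTop (𝓝 1) := by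
  simpa only [one_rpow] using! (tendsto_div_add_const_atTop (β ^ 2 / (2 * ν))).rpow_const
    (p := ν + (d : ℝ) / 2) (Or.inl one_ne_zero)

end SlowVariation

section RealIntegrals

open Real Set

theorem integrableOn_rpow_mul_add_rpow {a b s : ℝ} (ha : 0 < a) (hb : 0 < b) (hs : a < s) :
    IntegrableOn (fun u : ℝ => u ^ (a - 1) * (u + b) ^ (-s)) (Ioi 0) := by
  have hcont : ContinuousOn (fun u : ℝ => (u + b) ^ (-s)) (Ici 0) :=
    ContinuousOn.rpow_const (by fun_prop) fun u hu => Or.inl (add_pos_of_nonneg_of_pos hu hb).ne'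
  refine mellin_convergent_of_isBigO_scalar (a := s) (b := 0)
    ((hcont.mono Ioi_subset_Ici_self).locallyIntegrableOn measurableSet_Ioi) ?_ hs ?_ ha
  · refine IsBigO.of_bound 1 ((eventually_gt_atTop 0).mono fun u hu => ?_)
    rw [one_mul, norm_of_nonneg (by positivity), norm_of_nonneg (by positivity)]
    exact rpow_le_rpow_of_nonpos hu (by linarith) (by linarith)
  · simpa using ((hcont 0 self_mem_Ici).mono Ioi_subset_Ici_self).tendsto.isBigO_one ℝ

variable {E : Type*} [NormedAddCommGroup E] [NormedSpace ℝ E]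

theorem rpow_smul_integral_rpow_mul_exp_neg_smul {l : ℝ} (hl : 0 < l) (a : ℝ) (g : ℝ → E) :
    l ^ a • ∫ u in Ioi 0, (u ^ (a - 1) * exp (-(l * u))) • g u =
      ∫ v in Ioi 0, (exp (-v) * v ^ (a - 1)) • g (v / l) := by
  have hscale := integral_comp_mul_left_Ioi'
    (fun v => (exp (-v) * v ^ (a - 1)) • g (v / l)) 0 hl
  rw [mul_zero] at hscale
  rw [← hscale, ← integral_smul, ← integral_smul]
  refine setIntegral_congr_fun measurableSet_Ioi fun u hu => ?_
  have hla : l ^ a = l * l ^ (a - 1) := by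
    rw [rpow_sub_one hl.ne', mul_div_cancel₀ _ hl.ne']
  simp only [mul_div_cancel_left₀ _ hl.ne', mul_rpow hl.le (le_of_lt hu), hla, smul_smul]
  ring_nf

theorem tendsto_rpow_smul_integral_rpow_mul_exp_neg_smul [CompleteSpace E] {a M : ℝ} {g : ℝ → E}
    {c : E} (ha : 0 < a) (hg : StronglyMeasurable g) (hM : ∀ u, 0 < u → ‖g u‖ ≤ M)
    (hc : Tendsto g (𝓝[>] 0) (𝓝 c)) :
    Tendsto (fun l : ℝ => l ^ a • ∫ u in Ioi 0, (u ^ (a - 1) * exp (-(l * u))) • g u) atTop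
      (𝓝 (Gamma a • c)) := by
  rw [Gamma_eq_integral ha, ← integral_smul_const]
  refine Tendsto.congr' ((eventually_gt_atTop 0).mono fun l hl =>
    (rpow_smul_integral_rpow_mul_exp_neg_smul hl a g).symm) ?_
  refine tendsto_integral_filter_of_dominated_convergence
    (fun v => exp (-v) * v ^ (a - 1) * M) (Eventually.of_forall fun l => ?_) ?_
    ((GammaIntegral_convergent ha).mul_const M) ?_
  · have hgl : StronglyMeasurable fun v => g (v / l) := hg.comp_measurable (by fun_prop)
    have hΓ : Measurable fun v : ℝ => exp (-v) * v ^ (a - 1) := by fun_prop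
    exact (hΓ.stronglyMeasurable.smul hgl).aestronglyMeasurable
  · filter_upwards [eventually_gt_atTop 0] with l hl
    filter_upwards [self_mem_ae_restrict measurableSet_Ioi] with v hv
    have hΓ : 0 ≤ exp (-v) * v ^ (a - 1) := mul_nonneg (exp_nonneg _) (rpow_nonneg (le_of_lt hv) _)
    rw [norm_smul, norm_of_nonneg hΓ]
    exact mul_le_mul_of_nonneg_left (hM _ (div_pos hv hl)) hΓ
  · filter_upwards [self_mem_ae_restrict measurableSet_Ioi] with v hv
    have hvl : Tendsto (fun l : ℝ => v / l) atTop (𝓝[>] 0) :=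
      tendsto_nhdsWithin_iff.2 ⟨tendsto_const_nhds.div_atTop tendsto_id,
        (eventually_gt_atTop 0).mono fun l hl => div_pos hv hl⟩
    exact (hc.comp hvl).const_smul _

theorem isEquivalent_integral_rpow_mul_exp_neg_mul {a M c : ℝ} {g : ℝ → ℝ} (ha : 0 < a)
    (hg : Measurable g) (hM : ∀ u, 0 < u → ‖g u‖ ≤ M) (hc : Tendsto g (𝓝[>] 0) (𝓝 c))
    (hc0 : c ≠ 0) :
    (fun l : ℝ => ∫ u in Ioi 0, u ^ (a - 1) * exp (-(l * u)) * g u) ~[atTop]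
      fun l => Gamma a * c * l ^ (-a) := by
  have hconst := (isEquivalent_const_iff_tendsto (mul_ne_zero (Gamma_pos_of_pos ha).ne' hc0)).2
    (tendsto_rpow_smul_integral_rpow_mul_exp_neg_smul ha hg.stronglyMeasurable hM hc)
  refine (hconst.mul (IsEquivalent.refl (u := fun l : ℝ => l ^ (-a)))).congr_left ?_
  filter_upwards [eventually_gt_atTop 0] with l hl
  simp only [Pi.mul_apply, smul_eq_mul]
  rw [mul_right_comm, ← rpow_add hl, add_neg_cancel, rpow_zero, one_mul]

end RealIntegrals

noncomputable section ConfluentHypergeometric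

open Real Set

variable {d : ℕ} {ν α β σ : ℝ}

/-- The constant in front of the integral that defines `chCov`. -/
def chConst (ν α β σ : ℝ) : ℝ :=
  σ ^ 2 * β ^ (2 * α) * Gamma (ν + α) / (Gamma ν * Gamma α)

/-- The weight of the spectral density of `chCov` as a mixture of Gaussians with rate
`u / (4 * ν)`: its dual weight is the weight in the definition of `chCov`. -/
def chSpectralWeight (d : ℕ) (ν α β σ u : ℝ) : ℝ :=
  chConst ν α β σ * (4 * π * ν) ^ (-((d : ℝ) / 2)) *
    (u ^ (ν + (d : ℝ) / 2 - 1) * (u + β ^ 2) ^ (-(ν + α)))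

/-- The spectral density of `chCov`. -/
def chSpectralDensity (d : ℕ) (ν α β σ : ℝ) : ℝ≥0 → ℝ≥0∞ :=
  egaussianMixture (volume.restrict (Ioi 0)) (chSpectralWeight d ν α β σ) fun u => u / (4 * ν)

@[fun_prop]
theorem measurable_chSpectralWeight : Measurable (chSpectralWeight d ν α β σ) := by
  unfold chSpectralWeight
  fun_prop

theorem chSpectralWeight_nonneg (hν : 0 < ν) (hα : 0 < α) (hβ : 0 < β) {u : ℝ} (hu : 0 < u) :
    0 ≤ chSpectralWeight d ν α β σ u := by
  have := Gamma_pos_of_pos hν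
  have := Gamma_pos_of_pos hα
  have := Gamma_pos_of_pos (add_pos hν hα)
  unfold chSpectralWeight chConst
  positivity

theorem integrableOn_chSpectralWeight (hν : 0 < ν) (hβ : 0 < β) (hα : (d : ℝ) / 2 < α) :
    IntegrableOn (chSpectralWeight d ν α β σ) (Ioi 0) :=
  (integrableOn_rpow_mul_add_rpow (by positivity) (pow_pos hβ 2) (by linarith)).const_mul _

theorem dualWeight_chSpectralWeight (hν : 0 < ν) {u : ℝ} (hu : 0 < u) :
    dualWeight d (chSpectralWeight d ν α β σ) (fun u => u / (4 * ν)) u =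
      chConst ν α β σ * (u ^ (ν - 1) * (u + β ^ 2) ^ (-(ν + α))) := by
  have hbase : π / (u / (4 * ν)) = 4 * π * ν / u := by
    field_simp
  have hexp : ν + (d : ℝ) / 2 - 1 = (ν - 1) + (d : ℝ) / 2 := by ring
  have hpos : 0 < 4 * π * ν := by positivity
  rw [dualWeight, chSpectralWeight, hbase, hexp, div_rpow hpos.le hu.le, rpow_add hu,
    rpow_neg hpos.le]
  field_simp

theorem isGaussianMixing_chSpectralWeight (hν : 0 < ν) (hα : 0 < α) (hβ : 0 < β) :
    IsGaussianMixing d (volume.restrict (Ioi 0)) (chSpectralWeight d ν α β σ)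
      fun u => u / (4 * ν) where
  aemeasurable_weight := by fun_prop
  aemeasurable_rate := by fun_prop
  rate_pos := by
    filter_upwards [self_mem_ae_restrict measurableSet_Ioi] with u hu
    exact div_pos hu (by positivity)
  integrable_dualWeight :=
    IntegrableOn.congr_fun ((integrableOn_rpow_mul_add_rpow hν (pow_pos hβ 2)
      (lt_add_of_pos_right ν hα)).const_mul _)
      (fun _ hu => (dualWeight_chSpectralWeight hν hu).symm) measurableSet_Ioi

theorem chCov_eq_gaussianMixture (hν : 0 < ν) :
    chCov ν α β σ = gaussianMixture (volume.restrict (Ioi 0))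
      (dualWeight d (chSpectralWeight d ν α β σ) fun u => u / (4 * ν))
      (dualRate fun u => u / (4 * ν)) := by
  ext h
  rw [chCov, gaussianMixture, ← integral_const_mul]
  refine setIntegral_congr_fun measurableSet_Ioi fun u hu => ?_
  have hrate : dualRate (fun u => u / (4 * ν)) u * h ^ 2 = ν * h ^ 2 / u := by
    simp only [dualRate]
    field_simp
  simp only [dualWeight_chSpectralWeight hν hu, hrate, chConst, mul_assoc]

theorem isSpectralDensity_chSpectralDensity (hν : 0 < ν) (hα : 0 < α) (hβ : 0 < β) :
    IsSpectralDensity d (chCov ν α β σ) (chSpectralDensity d ν α β σ) := by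
  rw [chCov_eq_gaussianMixture (d := d) hν]
  refine (isGaussianMixing_chSpectralWeight hν hα hβ).isSpectralDensity ?_
  filter_upwards [self_mem_ae_restrict measurableSet_Ioi] with u hu
  exact chSpectralWeight_nonneg hν hα hβ hu

theorem toReal_chSpectralDensity (hν : 0 < ν) (hα : 0 < α) (hβ : 0 < β) (r : ℝ≥0) :
    (chSpectralDensity d ν α β σ r).toReal = gaussianMixture (volume.restrict (Ioi 0))
      (chSpectralWeight d ν α β σ) (fun u => u / (4 * ν)) r := by
  refine toReal_egaussianMixture (by fun_prop) (by fun_prop) ?_ r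
  filter_upwards [self_mem_ae_restrict measurableSet_Ioi] with u hu
  exact chSpectralWeight_nonneg hν hα hβ hu

theorem chSpectralDensity_lt_top (hν : 0 < ν) (hβ : 0 < β) (hα : (d : ℝ) / 2 < α) (r : ℝ≥0) :
    chSpectralDensity d ν α β σ r < ∞ := by
  refine egaussianMixture_lt_top ?_ (integrableOn_chSpectralWeight hν hβ hα) r
  filter_upwards [self_mem_ae_restrict measurableSet_Ioi] with u hu
  exact div_nonneg (le_of_lt hu) (by positivity)

theorem integrable_chCov_norm (hν : 0 < ν) (hβ : 0 < β) (hα : (d : ℝ) / 2 < α) :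
    Integrable fun x : EuclideanSpace ℝ (Fin d) => chCov ν α β σ ‖x‖ := by
  have hα0 : 0 < α := lt_of_le_of_lt (by positivity) hα
  rw [chCov_eq_gaussianMixture (d := d) hν]
  exact ((isGaussianMixing_chSpectralWeight hν hα0 hβ).dual
    (integrableOn_chSpectralWeight hν hβ hα)).integrable_norm finrank_euclideanSpace_fin

theorem toReal_chSpectralDensity_eq_integral_cexp (hν : 0 < ν) (hβ : 0 < β)
    (hα : (d : ℝ) / 2 < α) (ω : EuclideanSpace ℝ (Fin d)) :
    ((chSpectralDensity d ν α β σ ‖ω‖₊).toReal : ℂ) = (1 / (2 * (π : ℂ)) ^ d) *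
      ∫ x : EuclideanSpace ℝ (Fin d),
        Complex.exp (-(Complex.I * (inner ℝ ω x : ℝ))) * (chCov ν α β σ ‖x‖ : ℂ) := by
  have hα0 : 0 < α := lt_of_le_of_lt (by positivity) hα
  rw [toReal_chSpectralDensity hν hα0 hβ, coe_nnnorm, chCov_eq_gaussianMixture (d := d) hν]
  exact (isGaussianMixing_chSpectralWeight hν hα0 hβ).gaussianMixture_norm_eq_integral_cexp
    (integrableOn_chSpectralWeight hν hβ hα) finrank_euclideanSpace_fin ω

theorem toReal_chSpectralDensity_eq_integral_exp (hν : 0 < ν) (hα : 0 < α) (hβ : 0 < β)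
    (r : ℝ≥0) :
    (chSpectralDensity d ν α β σ r).toReal =
      chConst ν α β σ * (4 * π * ν) ^ (-((d : ℝ) / 2)) *
        ∫ u in Ioi 0, u ^ (ν + (d : ℝ) / 2 - 1) * exp (-((r : ℝ) ^ 2 / (4 * ν) * u)) *
          (u + β ^ 2) ^ (-(ν + α)) := by
  rw [toReal_chSpectralDensity hν hα hβ, gaussianMixture, ← integral_const_mul]
  refine integral_congr_ae (ae_of_all _ fun u => ?_)
  simp only [chSpectralWeight]
  ring_nf

theorem chSpectralDensity_leadingTerm_eq (hν : 0 < ν) (hβ : 0 < β) {ω : ℝ} (hω : 0 < ω) :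
    chConst ν α β σ * (4 * π * ν) ^ (-((d : ℝ) / 2)) * (Gamma (ν + (d : ℝ) / 2) *
        (β ^ 2) ^ (-(ν + α)) * (ω ^ 2 / (4 * ν)) ^ (-(ν + (d : ℝ) / 2))) =
      σ ^ 2 * 2 ^ (2 * ν) * ν ^ ν * Gamma (ν + α) / (π ^ ((d : ℝ) / 2) * β ^ (2 * ν) * Gamma α) *
        (Gamma (ν + (d : ℝ) / 2) / Gamma ν) * ω ^ (-(2 * ν + (d : ℝ))) := by
  have hω_pow : (ω ^ 2) ^ (ν + (d : ℝ) / 2) = ω ^ (2 * ν + (d : ℝ)) := by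
    rw [← rpow_natCast_mul hω.le]
    ring_nf
  have hβ_pow : (β ^ 2) ^ (ν + α) = β ^ (2 * ν) * β ^ (2 * α) := by
    rw [← rpow_natCast_mul hβ.le, ← rpow_add hβ]
    ring_nf
  have hν_pow : (4 * ν) ^ (ν + (d : ℝ) / 2) = 2 ^ (2 * ν) * ν ^ ν * (4 * ν) ^ ((d : ℝ) / 2) := by
    rw [rpow_add (by positivity), mul_rpow zero_le_four hν.le, rpow_mul zero_le_two]
    norm_num
  have hπ_pow : (4 * π * ν) ^ ((d : ℝ) / 2) = (4 * ν) ^ ((d : ℝ) / 2) * π ^ ((d : ℝ) / 2) := by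
    rw [← mul_rpow (by positivity) pi_pos.le, mul_right_comm]
  rw [chConst, rpow_neg (by positivity), rpow_neg (by positivity), rpow_neg (by positivity),
    rpow_neg hω.le, div_rpow (by positivity) (by positivity), hω_pow, hβ_pow, hν_pow, hπ_pow]
  field_simp

theorem isEquivalent_chSpectralDensity (hν : 0 < ν) (hα : 0 < α) (hβ : 0 < β) :
    (fun ω : ℝ => (chSpectralDensity d ν α β σ ω.toNNReal).toReal) ~[atTop]
      fun ω : ℝ =>
        σ ^ 2 * 2 ^ (2 * ν) * ν ^ ν * Gamma (ν + α) / (π ^ ((d : ℝ) / 2) * β ^ (2 * ν) * Gamma α) *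
          (Gamma (ν + (d : ℝ) / 2) / Gamma ν) * ω ^ (-(2 * ν + (d : ℝ))) := by
  have hβ2 : 0 < β ^ 2 := pow_pos hβ 2
  have hbound (u : ℝ) (hu : 0 < u) : ‖(u + β ^ 2) ^ (-(ν + α))‖ ≤ (β ^ 2) ^ (-(ν + α)) := by
    rw [norm_of_nonneg (by positivity)]
    exact rpow_le_rpow_of_nonpos hβ2 (by linarith) (by linarith)
  have hlim : Tendsto (fun u : ℝ => (u + β ^ 2) ^ (-(ν + α))) (𝓝[>] 0)
      (𝓝 ((β ^ 2) ^ (-(ν + α)))) := by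
    have h : ContinuousAt (fun u : ℝ => (u + β ^ 2) ^ (-(ν + α))) 0 :=
      ContinuousAt.rpow_const (by fun_prop) (Or.inl (by positivity))
    simpa using h.tendsto.mono_left nhdsWithin_le_nhds
  have hwatson := isEquivalent_integral_rpow_mul_exp_neg_mul (a := ν + (d : ℝ) / 2)
    (by positivity) (by fun_prop) hbound hlim (rpow_pos_of_pos hβ2 _).ne'
  have hl : Tendsto (fun ω : ℝ => ω ^ 2 / (4 * ν)) atTop atTop :=
    (tendsto_pow_atTop two_ne_zero).atTop_div_const (by positivity)
  have hscaled := (IsEquivalent.refl (l := atTop)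
    (u := fun _ : ℝ => chConst ν α β σ * (4 * π * ν) ^ (-((d : ℝ) / 2)))).mul
      (hwatson.comp_tendsto hl)
  refine (hscaled.congr_left ?_).congr_right ?_
  · filter_upwards [eventually_ge_atTop 0] with ω hω
    rw [toReal_chSpectralDensity_eq_integral_exp hν hα hβ, coe_toNNReal ω hω]
    rfl
  · filter_upwards [eventually_gt_atTop 0] with ω hω
    exact chSpectralDensity_leadingTerm_eq hν hβ hω

end ConfluentHypergeometric

theorem proposition1 (d : ℕ) (hd : 1 ≤ d) (ν α β σ : ℝ)
    (hν : 0 < ν) (hα : 0 < α) (hβ : 0 < β) (hσ : 0 < σ) :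
    (∃! f : ℝ≥0 → ℝ≥0∞, IsSpectralDensity d (chCov ν α β σ) f) ∧
    SlowlyVarying (tailL d ν β) ∧
    ∀ f : ℝ≥0 → ℝ≥0∞, IsSpectralDensity d (chCov ν α β σ) f →
      (fun ω : ℝ => (f ω.toNNReal).toReal) ~[atTop]
        (fun ω : ℝ =>
          σ ^ 2 * 2 ^ (2 * ν) * ν ^ ν * Real.Gamma (ν + α) /
              (Real.pi ^ ((d : ℝ) / 2) * β ^ (2 * ν) * Real.Gamma α) *
            (Real.Gamma (ν + (d : ℝ) / 2) / Real.Gamma ν) *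
            ω ^ (-(2 * ν + (d : ℝ))) * tailL d ν β (ω ^ 2)) ∧
      ((d : ℝ) / 2 < α →
        (∀ ω : ℝ≥0, f ω < ∞) ∧
        Integrable (fun x : EuclideanSpace ℝ (Fin d) => chCov ν α β σ ‖x‖) ∧
        ∀ ω : EuclideanSpace ℝ (Fin d),
          ((f ‖ω‖₊).toReal : ℂ) = (1 / (2 * (Real.pi : ℂ)) ^ d) *
            ∫ x : EuclideanSpace ℝ (Fin d),
              Complex.exp (-(Complex.I * (inner ℝ ω x : ℝ))) * (chCov ν α β σ ‖x‖ : ℂ)) := by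
  have hspec : IsSpectralDensity d (chCov ν α β σ) (chSpectralDensity d ν α β σ) :=
    isSpectralDensity_chSpectralDensity hν hα hβ
  have htail := tendsto_tailL d ν β
  refine ⟨⟨_, hspec, fun f hf => hf.unique hd hspec⟩,
    SlowlyVarying.of_tendsto one_ne_zero htail, fun f hf => ?_⟩
  obtain rfl := hf.unique hd hspec
  have htail_equiv : (fun ω : ℝ => tailL d ν β (ω ^ 2)) ~[atTop] fun _ => 1 :=
    (isEquivalent_const_iff_tendsto one_ne_zero).2 (htail.comp (tendsto_pow_atTop two_ne_zero))
  refine ⟨?_, fun hdα => ⟨chSpectralDensity_lt_top hν hβ hdα, integrable_chCov_norm hν hβ hdα,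
    toReal_chSpectralDensity_eq_integral_cexp hν hβ hdα⟩⟩
  simpa only [Pi.mul_def, mul_one] using
    (isEquivalent_chSpectralDensity hν hα hβ).mul htail_equiv.symm
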